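/- **Definitions.** All hypergraphs are finite. An $r$-partite $r$-graph is a hypergraph $H$ whose vertex set is a disjoint union $V_1\cup\dots\cup V_r$ such that every edge has size $r$ and contains exactly one vertex of each $V_i$. A cover of a set of edges is a set of vertices meeting each of these edges, and the cover number of $H$ is the minimum size of a cover of $E(H)$. For a positive integer $k$, $H$ has *intersecting $k$-covers* if there is a function $\phi\colon E(H)^k\to E(H)$ such that $\phi(T)$ is a cover of $T$ for every $k$-tuple $T$ of edges (repetitions allowed), and $\phi(T)\cap\phi(T')\neq\emptyset$ for all $k$-tuples $T,T'$ of edges. For positive integers $r,t$, let $\mathrm{kc}_r(t)$ be the minimum positive integer $k$ such that every $r$-partite $r$-graph with intersecting $k$-covers has cover number at most $t$ ($\mathrm{kc}_r(t)=\infty$ if there is no such $k$). For a graph $G$, let $\mathrm{tc}_r(G)$ be the minimum $m$ such that for every colouring of the edges of $G$ with $r$ colours there is a collection of at most $m$ monochromatic trees in $G$ (single vertices are allowed) that together cover all vertices of $G$; equivalently, one can use monochromatic components in place of trees. Finally, $\mathcal G(n,p)$ is the binomial random graph on $n$ vertices, and w.h.p. means with probability tending to $1$ as $n\to\infty$. **Theorem.**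 Let $r,t$ be positive integers such that $k=\mathrm{kc}_r(t)<\infty$. Then there exist constants $C,c>0$, depending only on $r$ and $t$, such that for every function $p=p(n)\in[0,1]$ and $G\sim\mathcal G(n,p)$: a) if $p<c\left(\frac{\log n}{n}\right)^{1/k}$ for all sufficiently large $n$, then w.h.p. $\mathrm{tc}_r(G)>t$; b) if $p>C\left(\frac{\log n}{n}\right)^{1/(k+1)}$ for all sufficiently large $n$, then w.h.p. $\mathrm{tc}_r(G)\le t$. -/

import Mathlib

open Filter Topology

namespace TreeCover

/-! ### Hypergraphs: covers, `r`-partite `r`-graphs, intersecting `k`-covers -/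

section Hypergraphs

variable {α : Type*}

/-- `S` meets every member of the family `F` of edges. -/
def Covers (S : Set α) (F : Set (Set α)) : Prop :=
  ∀ e ∈ F, (S ∩ e).Nonempty

/-- The (vertex) cover number: the minimum size of a set of vertices meeting every edge
(`⊤` if there is no finite cover). -/
noncomputable def coverNumber (H : Hypergraph α) : ℕ∞ :=
  ⨅ (S : Set α) (_ : S ⊆ H.vertexSet ∧ Covers S H.edgeSet), S.encard

/-- `H` is an `r`-partite `r`-graph: all edges have size `r`, and the vertex set is the disjoint
union of `r` parts, each of which meets every edge in exactly one vertex. -/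
def IsPartiteUniform (r : ℕ) (H : Hypergraph α) : Prop :=
  (∀ e ∈ H.edgeSet, e.encard = r) ∧
  ∃ P : Fin r → Set α,
    Pairwise (fun i j => Disjoint (P i) (P j)) ∧
    (⋃ i, P i) = H.vertexSet ∧
    ∀ e ∈ H.edgeSet, ∀ i, (e ∩ P i).encard = 1

/-- `H` has intersecting `k`-covers: one can assign to every `k`-tuple `T` of edges an edge `φ T`
covering `T`, in such a way that any two of the assigned edges intersect. -/
def HasIntersectingCovers (k : ℕ) (H : Hypergraph α) : Prop :=
  ∃ φ : (Fin k → H.edgeSet) → H.edgeSet,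
    (∀ T, Covers (φ T : Set α) (Set.range fun i => (T i : Set α))) ∧
    ∀ T T', ((φ T : Set α) ∩ (φ T' : Set α)).Nonempty

end Hypergraphs

/-- `kc_r(t)`: the least positive integer `k` such that every (finite) `r`-partite `r`-graph with
intersecting `k`-covers has cover number at most `t`; it is `⊤` if there is no such `k`. -/
noncomputable def kc (r t : ℕ) : ℕ∞ :=
  ⨅ (k : ℕ) (_ : 0 < k ∧ ∀ (α : Type) [Finite α] (H : Hypergraph α),
      IsPartiteUniform r H → HasIntersectingCovers k H → coverNumber H ≤ (t : ℕ∞)),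
    (k : ℕ∞)

/-! ### Monochromatic trees in edge-coloured graphs -/

section Graphs

variable {V : Type*}

/-- The subgraph `T` of `G` is a monochromatic tree under the edge-colouring `c` (a single vertex
is allowed). -/
def IsMonochromaticTree {r : ℕ} {G : SimpleGraph V} (c : G.EdgeLabeling (Fin r))
    (T : G.Subgraph) : Prop :=
  T.coe.IsTree ∧ ∃ i : Fin r, ∀ (u v : V) (h : T.Adj u v), c.get u v h.adj_sub = i

/-- `tc_r(G)`: the minimum `m` such that for every colouring of the edges of `G` with `r` colours
there is a collection of (at most) `m` monochromatic trees covering all vertices of `G`. -/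
noncomputable def tc (r : ℕ) (G : SimpleGraph V) : ℕ∞ :=
  sInf {m : ℕ∞ | ∀ c : G.EdgeLabeling (Fin r), ∃ F : Set G.Subgraph,
    F.encard ≤ m ∧ (∀ T ∈ F, IsMonochromaticTree c T) ∧ ∀ v : V, ∃ T ∈ F, v ∈ T.verts}

end Graphs

/-- The random graph `G(n, p)` with `p = p(n)` has the property `P` with high probability: the
probability that it does tends to `1` as `n → ∞`. -/
def Whp (p : ℕ → unitInterval) (P : ∀ n : ℕ, SimpleGraph (Fin n) → Prop) : Prop :=
  Tendsto (fun n : ℕ => SimpleGraph.binomialRandom (Fin n) (p n) {G | P n G}) atTop (𝓝 1)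

end TreeCover

/-! An `r`-partite hypergraph is encoded as a labelling `f : E → Fin r → L`: edges meet when their
labels agree in some coordinate. An edge colouring of `G` gives such a labelling of the vertices
(coordinate `i` is the colour-`i` component), in which adjacent vertices agree somewhere.
Conversely, a labelling with that property yields a colouring whose monochromatic trees have
constant labels in the coordinate of their colour. So `tc r G ≤ t` says exactly that every
compatible labelling of the vertices is coverable by `t` labels (`tc_le_of_forall_coverable`,
`coverable_of_tc_le`).

Sparse case: minimality of `k` provides an uncoverable labelling of a finite `E` with intersecting
`(k-1)`-covers. Suppose `G` contains an independent copy of `E` in which no `k` vertices have a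
common neighbour. Label the copy by `f`, and any other vertex by the edge that `φ` assigns to its at
most `k-1` neighbours in the copy. This is compatible and uncoverable (`lt_tc_of_sparse_copy`). One
copy succeeds with probability only about `n ^ (-δ)`, so a small power of `n` of disjoint copies are
tried (`measureReal_no_sparse_copy_le`).

Dense case: an uncoverable labelling has an uncoverable restriction to boundedly many vertices
(`exists_finite_witness`). Classify all vertices by how their labels agree with these witnesses;
there are boundedly many types. Every `k`-tuple has many common neighbours, hence a type popular
among them, which serves as `φ` of the tuple. Two popular types agree somewhere, because large
disjoint vertex sets span an edge. The definition of `kc` then covers the types, hence the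
witnesses, a contradiction (`tc_le_of_rich`). -/

namespace TreeCover

/-! ### Labellings as `r`-partite hypergraphs -/

section Labelings

variable {E F L : Type*} {r : ℕ}

/-- A labelling `f : E → Fin r → L` encodes an `r`-partite hypergraph: the edge `e` consists of the
vertices `(i, f e i)`. It is coverable by `t` labels if some `t` of these vertices meet all edges. -/
def Coverable (f : E → Fin r → L) (t : ℕ) : Prop :=
  ∃ S : Set (Fin r × L), S.encard ≤ t ∧ ∀ e, ∃ i, (i, f e i) ∈ S

/-- Intersecting `k`-covers for a labelling. -/
def HasSelector (k : ℕ) (f : E → Fin r → L) : Prop :=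
  ∃ φ : (Fin k → E) → E, (∀ T i, ∃ j, f (φ T) j = f (T i) j) ∧
    ∀ T T', ∃ j, f (φ T) j = f (φ T') j

theorem Coverable.comp {f : E → Fin r → L} {t : ℕ} (h : Coverable f t) (u : F → E) :
    Coverable (f ∘ u) t := by
  obtain ⟨S, hS, h⟩ := h
  exact ⟨S, hS, fun e => h (u e)⟩

/-- The set of vertices of the edge of a labelling. -/
def labelEdge (x : Fin r → L) : Set (Fin r × L) := Set.range fun i => (i, x i)

theorem mem_labelEdge {x : Fin r → L} {p : Fin r × L} : p ∈ labelEdge x ↔ x p.1 = p.2 := by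
  constructor
  · rintro ⟨i, rfl⟩; rfl
  · intro h; exact ⟨p.1, Prod.ext rfl h⟩

/-- The hypergraph of a labelling. -/
def labelHypergraph (f : E → Fin r → L) : Hypergraph (Fin r × L) where
  vertexSet := Set.univ
  edgeSet := Set.range fun e => labelEdge (f e)
  subset_vertexSet_of_mem_edgeSet' := fun _ _ => Set.subset_univ _

theorem isPartiteUniform_labelHypergraph (f : E → Fin r → L) :
    IsPartiteUniform r (labelHypergraph f) := by
  refine ⟨?_, fun i => {p | p.1 = i}, ?_, ?_, ?_⟩
  · rintro _ ⟨e, rfl⟩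
    have : Function.Injective fun i => (i, f e i) := fun i j h => (Prod.ext_iff.1 h).1
    change (Set.range _).encard = _
    rw [← Set.image_univ, this.encard_image]
    simp [Set.encard_univ]
  · intro i j hij
    rw [Set.disjoint_left]
    rintro p rfl h
    exact hij h
  · ext p; simp [labelHypergraph]
  · rintro _ ⟨e, rfl⟩ i
    have : labelEdge (f e) ∩ {p | p.1 = i} = {(i, f e i)} := by
      ext ⟨a, b⟩
      simp only [Set.mem_inter_iff, mem_labelEdge, Set.mem_ofPred_eq, Set.mem_singleton_iff,
        Prod.mk.injEq]
      constructor
      · rintro ⟨h, rfl⟩; exact ⟨rfl, h.symm⟩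
      · rintro ⟨rfl, rfl⟩; exact ⟨rfl, rfl⟩
    rw [this, Set.encard_singleton]

theorem labelEdge_inter_nonempty {x y : Fin r → L} :
    (labelEdge x ∩ labelEdge y).Nonempty ↔ ∃ j, x j = y j := by
  constructor
  · rintro ⟨p, h1, h2⟩
    rw [mem_labelEdge] at h1 h2
    exact ⟨p.1, h1.trans h2.symm⟩
  · rintro ⟨j, h⟩
    exact ⟨(j, x j), ⟨j, rfl⟩, mem_labelEdge.2 h.symm⟩

theorem HasSelector.hasIntersectingCovers {k : ℕ} {f : E → Fin r → L} (h : HasSelector k f) :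
    HasIntersectingCovers k (labelHypergraph f) := by
  obtain ⟨φ, h1, h2⟩ := h
  have hc : ∀ x : (labelHypergraph f).edgeSet, ∃ e, labelEdge (f e) = x := fun x => x.2
  choose g hg using hc
  refine ⟨fun T => ⟨labelEdge (f (φ (g ∘ T))), _, rfl⟩, ?_, ?_⟩
  · rintro T _ ⟨i, rfl⟩
    change (labelEdge _ ∩ ((T i : (labelHypergraph f).edgeSet) : Set (Fin r × L))).Nonempty
    rw [← hg (T i), labelEdge_inter_nonempty]
    exact h1 _ i
  · intro T T'
    exact labelEdge_inter_nonempty.2 (h2 _ _)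

theorem exists_cover_of_coverNumber_le {α : Type*} {H : Hypergraph α} {t : ℕ}
    (h : coverNumber H ≤ t) :
    ∃ S : Set α, S ⊆ H.vertexSet ∧ Covers S H.edgeSet ∧ S.encard ≤ t := by
  by_contra! hcon
  have : ((t : ℕ∞) + 1) ≤ coverNumber H :=
    le_iInf fun S => le_iInf fun hS => Order.add_one_le_of_lt (hcon S hS.1 hS.2)
  have h3 := this.trans h
  norm_cast at h3
  omega

theorem Coverable.of_coverNumber_le {f : E → Fin r → L} {t : ℕ}
    (h : coverNumber (labelHypergraph f) ≤ t) : Coverable f t := by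
  obtain ⟨S, -, hS, hcard⟩ := exists_cover_of_coverNumber_le h
  refine ⟨S, hcard, fun e => ?_⟩
  obtain ⟨p, hp, hpe⟩ := hS _ ⟨e, rfl⟩
  obtain ⟨i, rfl⟩ := hpe
  exact ⟨i, hp⟩

end Labelings

/-! ### Extremal consequences of `kc r t = k`, and bounded witnesses -/

section Threshold

variable {r t k : ℕ}

/-- The property defining `kc r t`. -/
def ForcesCover (r t k : ℕ) : Prop :=
  0 < k ∧ ∀ (α : Type) [Finite α] (H : Hypergraph α),
      IsPartiteUniform r H → HasIntersectingCovers k H → coverNumber H ≤ (t : ℕ∞)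

theorem forcesCover_of_kc_eq (hk : kc r t = (k : ℕ∞)) : ForcesCover r t k := by
  by_contra hcon
  have : ((k : ℕ∞) + 1) ≤ kc r t := by
    refine le_iInf fun j => le_iInf fun hj => ?_
    have h1 : kc r t ≤ (j : ℕ∞) := iInf₂_le (f := fun (k : ℕ) _ => (k : ℕ∞)) j hj
    rw [hk] at h1
    have h2 : k ≠ j := by rintro rfl; exact hcon hj
    norm_cast at h1 ⊢
    omega
  rw [hk] at this
  norm_cast at this
  omega

theorem not_forcesCover_of_lt {j : ℕ} (hk : kc r t = (k : ℕ∞)) (hj : j < k) :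
    ¬ ForcesCover r t j := by
  intro h
  have h1 : kc r t ≤ (j : ℕ∞) := iInf₂_le (f := fun (k : ℕ) _ => (k : ℕ∞)) j h
  rw [hk] at h1
  norm_cast at h1
  omega

/-- Only `L` has to be finite, since the hypergraph lives on `Fin r × L`; this is what permits an
arbitrary index type `E`. -/
theorem ForcesCover.coverable {E L : Type} [Finite L] (h : ForcesCover r t k)
    {f : E → Fin r → L} (hf : HasSelector k f) : Coverable f t :=
  .of_coverNumber_le (h.2 _ _ (isPartiteUniform_labelHypergraph f) hf.hasIntersectingCovers)

/-- An `r`-partite hypergraph with intersecting covers and large cover number yields a labelling. -/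
theorem exists_labeling_of_hypergraph {α : Type} [Finite α] {H : Hypergraph α}
    (hH : IsPartiteUniform r H) (hc : HasIntersectingCovers k H) (ht : ¬ coverNumber H ≤ (t : ℕ∞)) :
    ∃ (E L : Type) (_ : Finite E) (f : E → Fin r → L), HasSelector k f ∧ ¬ Coverable f t := by
  obtain ⟨-, P, hdisj, hun, hone⟩ := hH
  have hx : ∀ (e : H.edgeSet) (i : Fin r), ∃ x, (e : Set α) ∩ P i = {x} := fun e i =>
    Set.encard_eq_one.1 (hone e e.2 i)
  choose f hf using hx
  have hmem : ∀ (e : H.edgeSet) i, f e i ∈ (e : Set α) ∧ f e i ∈ P i := fun e i => by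
    have : f e i ∈ (e : Set α) ∩ P i := by rw [hf]; rfl
    exact this
  have hex : ∀ (e : H.edgeSet) x, x ∈ (e : Set α) → ∃ i, x ∈ P i ∧ f e i = x := fun e x hxe => by
    have : x ∈ ⋃ i, P i := by rw [hun]; exact H.subset_vertexSet_of_mem_edgeSet e.2 hxe
    obtain ⟨i, hi⟩ := Set.mem_iUnion.1 this
    have h2 : x ∈ (e : Set α) ∩ P i := ⟨hxe, hi⟩
    rw [hf] at h2
    exact ⟨i, hi, h2.symm⟩
  have hinter : ∀ e e' : H.edgeSet, ((e : Set α) ∩ (e' : Set α)).Nonempty → ∃ j, f e j = f e' j := by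
    rintro e e' ⟨x, h1, h2⟩
    obtain ⟨i, hi, hxi⟩ := hex e x h1
    obtain ⟨j, hj, hxj⟩ := hex e' x h2
    have : i = j := by
      by_contra hij
      exact Set.disjoint_left.1 (hdisj hij) hi hj
    subst this
    exact ⟨i, hxi.trans hxj.symm⟩
  obtain ⟨φ, h1, h2⟩ := hc
  refine ⟨H.edgeSet, α, inferInstance, f, ⟨φ, fun T i => hinter _ _ (h1 T _ ⟨i, rfl⟩),
    fun T T' => hinter _ _ (h2 T T')⟩, ?_⟩
  rintro ⟨S, hS, hcov⟩
  apply ht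
  let S' : Set α := Prod.snd '' (S ∩ {p | p.2 ∈ H.vertexSet})
  have hS' : S' ⊆ H.vertexSet ∧ Covers S' H.edgeSet := by
    constructor
    · rintro _ ⟨p, hp, rfl⟩; exact hp.2
    · intro e he
      obtain ⟨i, hi⟩ := hcov ⟨e, he⟩
      have hm := (hmem ⟨e, he⟩ i).1
      exact ⟨f ⟨e, he⟩ i, ⟨_, ⟨hi, H.subset_vertexSet_of_mem_edgeSet he hm⟩, rfl⟩, hm⟩
  calc coverNumber H ≤ S'.encard := iInf₂_le (f := fun (S : Set α) _ => S.encard) S' hS'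
    _ ≤ (S ∩ {p | p.2 ∈ H.vertexSet}).encard := Set.encard_image_le _ _
    _ ≤ S.encard := Set.encard_le_encard Set.inter_subset_left
    _ ≤ t := hS

/-- Below the threshold there is an uncoverable labelling with intersecting covers. -/
theorem exists_not_coverable (hr : 0 < r) (hk : kc r t = (k : ℕ∞)) :
    ∃ (E L : Type) (_ : Finite E) (f : E → Fin r → L),
      HasSelector (k - 1) f ∧ ¬ Coverable f t := by
  have hk0 := (forcesCover_of_kc_eq hk).1
  rcases Nat.eq_or_lt_of_le (Nat.succ_le_of_lt hk0) with h1 | h1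
  · subst h1
    -- For `k = 1` the only tuple is the empty one, so a constant `φ` suffices, and `t + 1` pairwise
    -- disjoint edges defeat any `t` labels.
    refine ⟨Fin (t + 1), Fin (t + 1), inferInstance, fun e _ => e,
      ⟨fun _ => 0, fun _ i => i.elim0, fun _ _ => ⟨⟨0, hr⟩, rfl⟩⟩, ?_⟩
    rintro ⟨S, hS, hcov⟩
    have h2 : Prod.snd '' S = Set.univ := by
      refine Set.eq_univ_of_forall fun e => ?_
      obtain ⟨i, hi⟩ := hcov e
      exact ⟨_, hi, rfl⟩
    have h3 := (Set.encard_image_le Prod.snd S).trans hS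
    rw [h2, Set.encard_univ] at h3
    simp only [ENat.card_eq_coe_fintype_card, Fintype.card_fin] at h3
    norm_cast at h3
    omega
  · have h2 := not_forcesCover_of_lt hk (j := k - 1) (by omega)
    simp only [ForcesCover, not_and, not_forall] at h2
    obtain ⟨α, hα, H, hH, hc, ht⟩ := h2 (by omega)
    exact exists_labeling_of_hypergraph hH hc ht

/-- If a labelling is not coverable by `t` labels, this is witnessed by boundedly many edges. -/
theorem exists_finite_witness.{u, v} (r t : ℕ) : ∃ (I : Type) (_ : Finite I),
    ∀ (E : Type u) (L : Type v) (f : E → Fin r → L), ¬ Coverable f t →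
      ∃ u : I → E, ¬ Coverable (f ∘ u) t := by
  induction t with
  | zero =>
    refine ⟨Unit, inferInstance, fun E L f hf => ?_⟩
    have : Nonempty E := by
      by_contra hE
      rw [not_nonempty_iff] at hE
      exact hf ⟨∅, by simp, fun e => hE.elim e⟩
    obtain ⟨e⟩ := this
    refine ⟨fun _ => e, ?_⟩
    rintro ⟨S, hS, h⟩
    obtain ⟨i, hi⟩ := h ()
    have : S = ∅ := by simpa using hS
    simp [this] at hi
  | succ t ih =>
    obtain ⟨I, hI, ih⟩ := ih
    refine ⟨Option (Fin r × I), inferInstance, fun E L f hf => ?_⟩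
    have : Nonempty E := by
      by_contra hE
      rw [not_nonempty_iff] at hE
      exact hf ⟨∅, by simp, fun e => hE.elim e⟩
    obtain ⟨e⟩ := this
    -- A cover must contain one of the `r` vertices of `e`. For each choice `i`, the edges avoiding
    -- `(i, f e i)` cannot be covered with one label fewer, so induction supplies a witness among
    -- them; `e` together with these `r` witnesses is enough.
    have key : ∀ i : Fin r, ∃ u : I → {e' : E // f e' i ≠ f e i},
        ¬ Coverable ((fun e' : {e' : E // f e' i ≠ f e i} => f e') ∘ u) t := by
      intro i
      apply ih
      rintro ⟨S, hS, h⟩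
      refine hf ⟨insert (i, f e i) S, ?_, fun e' => ?_⟩
      · calc _ ≤ S.encard + 1 := Set.encard_insert_le _ _
          _ ≤ (t : ℕ∞) + 1 := by gcongr
          _ = _ := by push_cast; rfl
      · by_cases h' : f e' i = f e i
        · exact ⟨i, Or.inl (by rw [h'])⟩
        · obtain ⟨j, hj⟩ := h ⟨e', h'⟩
          exact ⟨j, Or.inr hj⟩
    choose u hu using key
    refine ⟨fun o => o.elim e fun p => u p.1 p.2, ?_⟩
    rintro ⟨S, hS, h⟩
    obtain ⟨i, hi⟩ := h none
    apply hu i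
    refine ⟨S \ {(i, f e i)}, ?_, fun a => ?_⟩
    · have := Set.encard_sdiff_singleton_add_one hi
      have h2 : (S \ {(i, f e i)}).encard + 1 ≤ (t : ℕ∞) + 1 := by
        refine this.le.trans (hS.trans ?_)
        push_cast; rfl
      exact (ENat.add_le_add_iff_right (by simp)).1 h2
    · obtain ⟨j, hj⟩ := h (some (i, a))
      refine ⟨j, hj, ?_⟩
      intro heq
      simp only [Set.mem_singleton_iff, Prod.mk.injEq] at heq
      obtain ⟨rfl, h3⟩ := heq
      exact (u j a).2 h3

end Threshold

/-! ### Monochromatic trees versus compatible labellings -/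

section Trees

variable {V : Type*} {r t k : ℕ} {G : SimpleGraph V}

/-- `tc` is at most `t` when every labelling compatible with adjacency is coverable. -/
theorem tc_le_of_forall_coverable
    (h : ∀ g : V → Fin r → Set V, (∀ v w, G.Adj v w → ∃ i, g v i = g w i) → Coverable g t) :
    tc r G ≤ t := by
  refine sInf_le fun c => ?_
  let g : V → Fin r → Set V := fun v i => {w | (c.labelGraph i).Reachable v w}
  obtain ⟨S, hS, hcov⟩ := h g fun v w hvw => by
    refine ⟨c.get v w hvw, ?_⟩
    have hadj : (c.labelGraph (c.get v w hvw)).Adj v w :=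
      (SimpleGraph.EdgeLabeling.labelGraph_adj v w).2 ⟨hvw, rfl⟩
    ext x
    exact ⟨fun hx => hadj.reachable.symm.trans hx, fun hx => hadj.reachable.trans hx⟩
  -- a spanning tree of each colour component
  have tree : ∀ (v : V) (i : Fin r), ∃ T : G.Subgraph, IsMonochromaticTree c T ∧
      T.verts = g v i := by
    intro v i
    let A : Set V := g v i
    have hconn : ((c.labelGraph i).induce A).Connected := by
      have : A = ((c.labelGraph i).connectedComponentMk v).supp := by
        ext x
        simp only [A, g, Set.mem_ofPred_eq, SimpleGraph.ConnectedComponent.mem_supp_iff,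
          SimpleGraph.ConnectedComponent.eq]
        exact ⟨fun h => h.symm, fun h => h.symm⟩
      rw [this]
      exact SimpleGraph.ConnectedComponent.connected_toSimpleGraph _
    obtain ⟨T, hT, htree⟩ := hconn.exists_isTree_le
    have hadj : ∀ {x y : V}, (∃ (hx : x ∈ A) (hy : y ∈ A), T.Adj ⟨x, hx⟩ ⟨y, hy⟩) →
        (c.labelGraph i).Adj x y := by
      rintro x y ⟨hx, hy, hxy⟩
      exact hT hxy
    refine ⟨{ verts := A
              Adj := fun x y => ∃ (hx : x ∈ A) (hy : y ∈ A), T.Adj ⟨x, hx⟩ ⟨y, hy⟩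
              adj_sub := fun hxy => c.labelGraph_le (hadj hxy)
              edge_vert := fun ⟨hx, _, _⟩ => hx
              symm := ⟨fun x y ⟨hx, hy, hxy⟩ => ⟨hy, hx, hxy.symm⟩⟩ }, ⟨?_, i, ?_⟩, rfl⟩
    · convert htree
      ext ⟨x, hx⟩ ⟨y, hy⟩
      simp only [SimpleGraph.Subgraph.coe_adj]
      exact ⟨fun ⟨_, _, h⟩ => h, fun h => ⟨hx, hy, h⟩⟩
    · intro x y hxy
      obtain ⟨_, h2⟩ := (SimpleGraph.EdgeLabeling.labelGraph_adj x y).1 (hadj hxy)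
      exact h2
  choose T hT hverts using tree
  -- `S` may contain labels that are not components; these cover nothing and are discarded so that
  -- each remaining label has a tree.
  let S' : Set (Fin r × Set V) := S ∩ {p | ∃ v, p.2 = g v p.1}
  have hS' : ∀ p : S', ∃ v, p.1.2 = g v p.1.1 := fun p => p.2.2
  choose w hw using hS'
  refine ⟨Set.range fun p : S' => T (w p) p.1.1, ?_, ?_, ?_⟩
  · calc _ ≤ (Set.univ : Set S').encard := by rw [← Set.image_univ]; exact Set.encard_image_le _ _
      _ = S'.encard := by rw [Set.encard_univ]; rfl
      _ ≤ S.encard := Set.encard_le_encard Set.inter_subset_left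
      _ ≤ t := hS
  · rintro _ ⟨p, rfl⟩
    exact hT _ _
  · intro v
    obtain ⟨i, hi⟩ := hcov v
    let p : S' := ⟨(i, g v i), hi, v, rfl⟩
    refine ⟨_, ⟨p, rfl⟩, ?_⟩
    rw [hverts, ← hw p]
    exact SimpleGraph.Reachable.refl v

/-- A labelling compatible with adjacency is coverable by `t` labels when `tc` is at most `t`. -/
theorem coverable_of_tc_le {L : Type*} (h : tc r G ≤ t) (g : V → Fin r → L)
    (hg : ∀ v w, G.Adj v w → ∃ i, g v i = g w i) : Coverable g t := by
  classical
  -- Each edge is coloured by a coordinate in which its ends agree.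
  have hcol : ∃ c : G.EdgeLabeling (Fin r), ∀ v w (h : G.Adj v w),
      g v (c.get v w h) = g w (c.get v w h) := by
    have : ∀ e : G.edgeSet, ∃ i : Fin r, ∀ v w, (e : Sym2 V) = s(v, w) → g v i = g w i := by
      rintro ⟨e, he⟩
      induction e using Sym2.inductionOn with
      | hf x y =>
        obtain ⟨i, hi⟩ := hg x y he
        refine ⟨i, fun v w hvw => ?_⟩
        rcases Sym2.eq_iff.1 hvw with ⟨rfl, rfl⟩ | ⟨rfl, rfl⟩
        · exact hi
        · exact hi.symm
    choose c hc using this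
    exact ⟨c, fun v w h => hc ⟨s(v, w), h⟩ v w rfl⟩
  obtain ⟨c, hc⟩ := hcol
  by_contra hcon
  have hlt : ((t : ℕ∞) + 1) ≤ tc r G := by
    refine le_sInf fun m hm => ?_
    obtain ⟨F, hF, htree, hcov⟩ := hm c
    by_contra hmt
    apply hcon
    have hFt : F.encard ≤ t := by
      refine hF.trans ?_
      rw [not_le] at hmt
      exact Order.le_of_lt_add_one hmt
    have hlab : ∀ T : F, ∃ p : Fin r × L, ∀ v ∈ (T : G.Subgraph).verts, g v p.1 = p.2 := by
      rintro ⟨T, hT⟩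
      obtain ⟨htr, i, hi⟩ := htree T hT
      obtain ⟨⟨x, hx⟩⟩ := htr.1.nonempty
      refine ⟨(i, g x i), fun v hv => ?_⟩
      obtain ⟨W⟩ := htr.1.preconnected ⟨v, hv⟩ ⟨x, hx⟩
      have : ∀ {a b : T.verts} (_ : T.coe.Walk a b), g a i = g b i := by
        intro a b W
        induction W with
        | nil => rfl
        | cons hab _ ih =>
          rw [← ih]
          have := hc _ _ (T.adj_sub hab)
          rwa [hi _ _ hab] at this
      exact this W
    choose p hp using hlab
    refine ⟨Set.range p, ?_, fun v => ?_⟩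
    · calc _ ≤ (Set.univ : Set F).encard := by rw [← Set.image_univ]; exact Set.encard_image_le _ _
        _ = F.encard := by rw [Set.encard_univ]; rfl
        _ ≤ t := hFt
    · obtain ⟨T, hT, hv⟩ := hcov v
      refine ⟨(p ⟨T, hT⟩).1, ⟨T, hT⟩, ?_⟩
      exact Prod.ext rfl (hp ⟨T, hT⟩ v hv).symm
  have h3 := hlt.trans h
  norm_cast at h3
  omega

/-- An independent copy of the edges of an uncoverable labelling, no `k + 1` of which have a common
neighbour, forces many trees. -/
theorem lt_tc_of_sparse_copy {E L : Type*} [Finite E] {f : E → Fin r → L}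
    (hf : HasSelector k f) (hft : ¬ Coverable f t) {u : E → V} (hu : Function.Injective u)
    (hind : ∀ a b, ¬ G.Adj (u a) (u b)) (hnb : ∀ w, {a | G.Adj (u a) w}.ncard ≤ k) :
    (t : ℕ∞) < tc r G := by
  classical
  by_contra hcon
  rw [not_lt] at hcon
  obtain ⟨φ, h1, h2⟩ := hf
  have hE : Nonempty E := by
    by_contra hE
    rw [not_nonempty_iff] at hE
    exact hft ⟨∅, by simp, fun e => hE.elim e⟩
  have enum : ∀ w, ∃ T : Fin k → E, ∀ a, G.Adj (u a) w → ∃ i, T i = a := by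
    intro w
    have hfin : {a | G.Adj (u a) w}.Finite := Set.toFinite _
    obtain ⟨s, hs⟩ : ∃ s : Finset E, (s : Set E) = {a | G.Adj (u a) w} := hfin.exists_finset_coe
    have hcard : s.card ≤ k := by
      have := hnb w
      rwa [← hs, Set.ncard_coe_finset] at this
    have e := s.equivFin
    -- Fewer than `k` neighbours are padded with an arbitrary edge: asking `φ` to cover more does no
    -- harm.
    refine ⟨fun i => if h : (i : ℕ) < s.card then (e.symm ⟨i, h⟩ : E) else hE.some, fun a ha => ?_⟩
    have has : a ∈ s := by
      have : a ∈ (s : Set E) := by rw [hs]; exact ha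
      exact this
    refine ⟨⟨e ⟨a, has⟩, (e ⟨a, has⟩).2.trans_le hcard⟩, ?_⟩
    simp
  choose T hT using enum
  -- Edges leaving the copy are compatible because `φ (T w)` covers the neighbours of `w` in the
  -- copy, edges outside it because any two values of `φ` intersect; inside the copy there are none.
  let h : V → E := fun w => if hw : ∃ a, u a = w then hw.choose else φ (T w)
  have hh : ∀ a, h (u a) = a := fun a => by
    have hw : ∃ b, u b = u a := ⟨a, rfl⟩
    simp only [h, dif_pos hw]
    exact hu hw.choose_spec
  have hcov := coverable_of_tc_le hcon (f ∘ h) fun v w hvw => by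
    have side : ∀ a w, G.Adj (u a) w → ∃ i, f (h (u a)) i = f (h w) i := by
      intro a w haw
      have hw : ¬ ∃ b, u b = w := by
        rintro ⟨b, rfl⟩; exact hind _ _ haw
      rw [hh]
      simp only [h, dif_neg hw]
      obtain ⟨i, hi⟩ := hT w a haw
      obtain ⟨j, hj⟩ := h1 (T w) i
      exact ⟨j, by rw [hj, hi]⟩
    by_cases hv : ∃ a, u a = v
    · obtain ⟨a, rfl⟩ := hv
      exact side a w hvw
    · by_cases hw : ∃ a, u a = w
      · obtain ⟨a, rfl⟩ := hw
        obtain ⟨i, hi⟩ := side a v hvw.symm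
        exact ⟨i, hi.symm⟩
      · simp only [Function.comp, h, dif_neg hv, dif_neg hw]
        exact h2 _ _
  have := hcov.comp u
  rw [show (f ∘ h) ∘ u = f by funext a; simp [hh]] at this
  exact hft this

/-- If all `k`-tuples of vertices have large common neighbourhoods and all pairs of large vertex sets
span edges, then few trees suffice. -/
theorem tc_le_of_rich {V : Type*} [Fintype V] {G : SimpleGraph V} {I : Type} [Finite I] (hr : 0 < r)
    (hk : ForcesCover r t k)
    (hI : ∀ f : V → Fin r → Set V, ¬ Coverable f t → ∃ u : I → V, ¬ Coverable (f ∘ u) t)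
    {s : ℕ} (hs0 : 0 < s) (hN : ∀ T : Fin k → V,
      s * Nat.card (Fin r → Set I) ≤ {w | ∀ i, G.Adj (T i) w}.ncard)
    (hs : ∀ A B : Finset V, A.card = s → B.card = s → Disjoint A B → ∃ a ∈ A, ∃ b ∈ B, G.Adj a b) :
    tc r G ≤ t := by
  classical
  have := Fintype.ofFinite I
  refine tc_le_of_forall_coverable fun f hf => ?_
  by_contra hcon
  obtain ⟨u, hu⟩ := hI f hcon
  apply hu
  -- The type of `w`: in each coordinate, the witnesses whose label it shares. It takes values in a
  -- finite set independent of `V`, and agreement of labels passes to agreement of types.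
  let g : V → Fin r → Set I := fun w i => {a | f (u a) i = f w i}
  have hg : ∀ v w, G.Adj v w → ∃ i, g v i = g w i := fun v w hvw => by
    obtain ⟨i, hi⟩ := hf v w hvw
    exact ⟨i, by simp only [g, hi]⟩
  -- Pigeonhole: `s` times as many common neighbours as types force `s` of one type.
  have pop : ∀ T : Fin k → V, ∃ v, (∀ i, G.Adj (T i) v) ∧
      ∃ A : Finset V, A.card = s ∧ ∀ w ∈ A, (∀ i, G.Adj (T i) w) ∧ g w = g v := by
    intro T
    obtain ⟨y, -, hy⟩ := Finset.exists_le_card_fiber_of_mul_le_card_of_maps_to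
      (s := Finset.univ.filter fun w => ∀ i, G.Adj (T i) w)
      (t := (Finset.univ : Finset (Fin r → Set I))) (f := g) (n := s)
      (fun _ _ => Finset.mem_univ _) ⟨fun _ => ∅, Finset.mem_univ _⟩ (by
        have := hN T
        rw [Set.ncard_eq_toFinset_card', Nat.card_eq_fintype_card] at this
        rw [Finset.card_univ, mul_comm]
        convert this using 2
        ext w; simp)
    obtain ⟨A, hA, hAs⟩ := Finset.exists_subset_card_eq hy
    have hmem : ∀ w ∈ A, (∀ i, G.Adj (T i) w) ∧ g w = y := fun w hw => by
      simpa using hA hw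
    obtain ⟨v, hv⟩ := Finset.card_pos.1 (hAs ▸ hs0)
    exact ⟨v, (hmem v hv).1, A, hAs, fun w hw => ⟨(hmem w hw).1,
      (hmem w hw).2.trans (hmem v hv).2.symm⟩⟩
  choose φ h1 A hA hAg using pop
  have hsel : HasSelector k (fun x : Set.range g => (x : Fin r → Set I)) := by
    have hc : ∀ x : Set.range g, ∃ v, g v = x := fun x => x.2
    choose rep hrep using hc
    refine ⟨fun T => ⟨g (φ (rep ∘ T)), _, rfl⟩, fun T i => ?_, fun T T' => ?_⟩
    · obtain ⟨j, hj⟩ := hg _ _ (h1 (rep ∘ T) i)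
      refine ⟨j, ?_⟩
      exact hj.symm.trans (congrFun (hrep (T i)) j)
    · by_cases hd : Disjoint (A (rep ∘ T)) (A (rep ∘ T'))
      · obtain ⟨a, ha, b, hb, hab⟩ := hs _ _ (hA _) (hA _) hd
        obtain ⟨j, hj⟩ := hg _ _ hab
        rw [(hAg _ a ha).2, (hAg _ b hb).2] at hj
        exact ⟨j, hj⟩
      · rw [Finset.not_disjoint_iff] at hd
        obtain ⟨a, ha, hb⟩ := hd
        refine ⟨⟨0, hr⟩, ?_⟩
        exact congrFun ((hAg _ a ha).2.symm.trans (hAg _ a hb).2) _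
  obtain ⟨S, hS, hcov⟩ := (hk.coverable hsel).comp fun a : I => (⟨g (u a), _, rfl⟩ : Set.range g)
  -- A nonempty set of witnesses in coordinate `i` goes back to the label of any of its members. The
  -- default `∅` is harmless, as the type of `u a` contains `a` in every coordinate.
  let lab : Fin r × Set I → Fin r × Set V := fun p =>
    (p.1, if h : p.2.Nonempty then f (u h.some) p.1 else ∅)
  refine ⟨lab '' S, (Set.encard_image_le _ _).trans hS, fun a => ?_⟩
  obtain ⟨i, hi⟩ := hcov a
  refine ⟨i, _, hi, Prod.ext rfl ?_⟩
  have hne : (g (u a) i).Nonempty := ⟨a, rfl⟩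
  simp only [lab, Function.comp, dif_pos hne]
  exact hne.some_mem

end Trees

/-! ### Independence of edges in the binomial random graph, and a tail bound -/

section RandomGraph

open MeasureTheory ProbabilityTheory SimpleGraph unitInterval

variable {V : Type*} {p : unitInterval}

/-- The event `A` is determined by the edges in `B`. -/
def DeterminedBy (B : Set (Sym2 V)) (A : Set (SimpleGraph V)) : Prop :=
  ∀ G G' : SimpleGraph V, (∀ e ∈ B, e ∈ G.edgeSet ↔ e ∈ G'.edgeSet) → G ∈ A → G' ∈ A

theorem DeterminedBy.compl {B : Set (Sym2 V)} {A : Set (SimpleGraph V)} (h : DeterminedBy B A) :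
    DeterminedBy B Aᶜ :=
  fun G G' hG hA hA' => hA (h G' G (fun e he => (hG e he).symm) hA')

theorem DeterminedBy.biInter {ι : Type*} {s : Finset ι} {B : ι → Set (Sym2 V)}
    {A : ι → Set (SimpleGraph V)} (h : ∀ i ∈ s, DeterminedBy (B i) (A i)) :
    DeterminedBy (⋃ i ∈ s, B i) (⋂ i ∈ s, A i) := by
  intro G G' hG hA
  simp only [Set.mem_iInter] at hA ⊢
  exact fun i hi => h i hi G G' (fun e he => hG e (Set.mem_biUnion hi he)) (hA i hi)

theorem determinedBy_mem_edgeSet (e : Sym2 V) :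
    DeterminedBy {e} {G : SimpleGraph V | e ∈ G.edgeSet} :=
  fun _ _ hG hA => (hG e rfl).1 hA

variable [Finite V]

theorem measurableSet_simpleGraph (A : Set (SimpleGraph V)) : MeasurableSet A := by
  rw [← measurableEmbedding_edgeSet.measurableSet_image]
  exact MeasurableSet.of_discrete

/-- The law of a single potential edge. -/
noncomputable def edgeLaw (p : unitInterval) (e : Sym2 V) : Measure Prop :=
  toNNReal p • .dirac (¬ e.IsDiag) + toNNReal (σ p) • .dirac False

instance (e : Sym2 V) : IsProbabilityMeasure (edgeLaw p e) := by
  constructor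
  simp [edgeLaw]

theorem measurable_mem_edgeSet (e : Sym2 V) :
    Measurable fun G : SimpleGraph V => e ∈ G.edgeSet := by
  intro s _
  exact measurableSet_simpleGraph _

/-- The random edge set is the image of a product measure that almost surely avoids the diagonal, so
`fromEdgeSet` loses nothing. This is the source of all independence statements below. -/
theorem map_mem_edgeSet : (binomialRandom V p).map (fun G e => e ∈ G.edgeSet) =
    Measure.infinitePi (edgeLaw p : Sym2 V → Measure Prop) := by
  have hset : setBernoulli (Sym2.diagSetᶜ : Set (Sym2 V)) p =
      (Measure.infinitePi (edgeLaw p : Sym2 V → Measure Prop)).map fun q => {e | q e} := by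
    rw [setBernoulli_eq_map]
    rfl
  have hm1 : Measurable fun q : Sym2 V → Prop => {e | q e} := by fun_prop
  have hm2 : Measurable fun (G : SimpleGraph V) e => e ∈ G.edgeSet :=
    measurable_pi_lambda _ measurable_mem_edgeSet
  have hae := setBernoulli_ae_subset (u := (Sym2.diagSetᶜ : Set (Sym2 V))) (p := p)
  rw [hset] at hae
  have hae' := ae_of_ae_map hm1.aemeasurable hae
  rw [binomialRandom_eq_map, Measure.map_map hm2 measurable_fromEdgeSet, hset,
    Measure.map_map (hm2.comp measurable_fromEdgeSet) hm1]
  conv_rhs => rw [← Measure.map_id (μ := Measure.infinitePi (edgeLaw p : Sym2 V → Measure Prop))]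
  refine Measure.map_congr ?_
  filter_upwards [hae'] with q hq
  funext e
  have : q e → ¬ e.IsDiag := fun h => hq h
  simpa using this

theorem map_mem_edgeSet_apply (e : Sym2 V) :
    (binomialRandom V p).map (fun G => e ∈ G.edgeSet) = edgeLaw p e := by
  rw [← Measure.infinitePi_map_eval (edgeLaw p : Sym2 V → Measure Prop) e, ← map_mem_edgeSet,
    Measure.map_map (measurable_pi_apply e) (measurable_pi_lambda _ measurable_mem_edgeSet)]
  rfl

theorem iIndepFun_mem_edgeSet :
    iIndepFun (fun (e : Sym2 V) (G : SimpleGraph V) => e ∈ G.edgeSet) (binomialRandom V p) := by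
  rw [iIndepFun_iff_map_fun_eq_infinitePi_map measurable_mem_edgeSet, map_mem_edgeSet]
  simp_rw [map_mem_edgeSet_apply]

theorem measureReal_mem_edgeSet {e : Sym2 V} (he : ¬ e.IsDiag) :
    (binomialRandom V p).real {G | e ∈ G.edgeSet} = p := by
  have h : (binomialRandom V p) {G | e ∈ G.edgeSet} = edgeLaw p e {True} := by
    rw [← map_mem_edgeSet_apply, Measure.map_apply (measurable_mem_edgeSet e) .of_discrete]
    congr 1
    ext G; simp
  rw [measureReal_def, h]
  simp [edgeLaw, he]

/-- An event determined by `B` is the preimage of its own image under restriction to `B`, and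
restrictions to disjoint blocks of independent variables are independent. -/
theorem DeterminedBy.inter_eq_mul {B C : Set (Sym2 V)} {A A' : Set (SimpleGraph V)}
    (h : DeterminedBy B A) (h' : DeterminedBy C A') (hBC : Disjoint B C) :
    binomialRandom V p (A ∩ A') = binomialRandom V p A * binomialRandom V p A' := by
  classical
  have := Fintype.ofFinite V
  have hind := (iIndepFun_mem_edgeSet (V := V) (p := p)).indepFun_finset B.toFinset C.toFinset
    (by simpa using hBC) measurable_mem_edgeSet
  have key : ∀ {B : Set (Sym2 V)} {A : Set (SimpleGraph V)}, DeterminedBy B A →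
      A = (fun (G : SimpleGraph V) (e : B.toFinset) => (e : Sym2 V) ∈ G.edgeSet) ⁻¹'
        ((fun (G : SimpleGraph V) (e : B.toFinset) => (e : Sym2 V) ∈ G.edgeSet) '' A) := by
    intro B A h
    refine Set.Subset.antisymm (Set.subset_preimage_image _ _) ?_
    rintro G ⟨G', hG', heq⟩
    exact h G' G (fun e he => by
      have := congrFun heq ⟨e, Set.mem_toFinset.2 he⟩
      exact iff_of_eq this) hG'
  rw [key h, key h']
  exact hind.measure_inter_preimage_eq_mul _ _ MeasurableSet.of_discrete MeasurableSet.of_discrete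

/-- Events determined by pairwise disjoint sets of edges are independent. -/
theorem iIndepSet_of_determinedBy {ι : Type*} {B : ι → Set (Sym2 V)} {A : ι → Set (SimpleGraph V)}
    (h : ∀ i, DeterminedBy (B i) (A i)) (hB : Pairwise fun i j => Disjoint (B i) (B j)) :
    iIndepSet A (binomialRandom V p) := by
  classical
  rw [iIndepSet_iff_meas_biInter fun _ => measurableSet_simpleGraph _]
  intro s
  induction s using Finset.induction_on with
  | empty => simp
  | insert a s ha ih =>
    rw [Finset.set_biInter_insert, Finset.prod_insert ha, ← ih]
    refine (h a).inter_eq_mul (DeterminedBy.biInter fun i _ => h i) ?_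
    simp only [Set.disjoint_iUnion_right]
    exact fun i hi => hB (by rintro rfl; exact ha hi)

theorem measureReal_biInter_of_determinedBy {ι : Type*} {B : ι → Set (Sym2 V)}
    {A : ι → Set (SimpleGraph V)} (h : ∀ i, DeterminedBy (B i) (A i))
    (hB : Pairwise fun i j => Disjoint (B i) (B j)) (s : Finset ι) :
    (binomialRandom V p).real (⋂ i ∈ s, A i) = ∏ i ∈ s, (binomialRandom V p).real (A i) := by
  simp only [measureReal_def, (iIndepSet_of_determinedBy h hB).meas_biInter s, ENNReal.toReal_prod]

theorem measureReal_forall_mem_edgeSet (s : Finset (Sym2 V)) (hs : ∀ e ∈ s, ¬ e.IsDiag) :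
    (binomialRandom V p).real {G | ∀ e ∈ s, e ∈ G.edgeSet} = (p : ℝ) ^ s.card := by
  have := measureReal_biInter_of_determinedBy (p := p) (determinedBy_mem_edgeSet (V := V))
    (fun i j hij => by simpa using hij) s
  rw [Finset.prod_congr rfl fun e he => measureReal_mem_edgeSet (hs e he), Finset.prod_const] at this
  rw [← this]
  congr 1
  ext G; simp

theorem measureReal_forall_notMem_edgeSet (s : Finset (Sym2 V)) (hs : ∀ e ∈ s, ¬ e.IsDiag) :
    (binomialRandom V p).real {G | ∀ e ∈ s, e ∉ G.edgeSet} = (1 - (p : ℝ)) ^ s.card := by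
  have := measureReal_biInter_of_determinedBy (p := p)
    (fun e => (determinedBy_mem_edgeSet (V := V) e).compl)
    (fun i j hij => by simpa using hij) s
  have h2 : ∀ e ∈ s, (binomialRandom V p).real {G | e ∈ G.edgeSet}ᶜ = 1 - (p : ℝ) := fun e he => by
    rw [probReal_compl_eq_one_sub (measurableSet_simpleGraph _), measureReal_mem_edgeSet (hs e he)]
  rw [Finset.prod_congr rfl h2, Finset.prod_const] at this
  rw [← this]
  congr 1
  ext G; simp

theorem measureReal_iUnion_le_of_forall_le {Ω ι : Type*} [MeasurableSpace Ω] {μ : Measure Ω}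
    [Fintype ι] {A : ι → Set Ω} {b : ℝ} (h : ∀ i, μ.real (A i) ≤ b) :
    μ.real (⋃ i, A i) ≤ Fintype.card ι * b := by
  refine (measureReal_iUnion_fintype_le A).trans ((Finset.sum_le_sum fun i _ => h i).trans_eq ?_)
  simp

/-- A lower tail bound for the number of occurring events in an independent family. -/
theorem measureReal_ncard_lt_le {Ω ι : Type*} [MeasurableSpace Ω] {μ : Measure Ω}
    [IsProbabilityMeasure μ] [Fintype ι] {A : ι → Set Ω} (hA : ∀ i, MeasurableSet (A i))
    (hind : iIndepSet A μ) {q : ℝ} (hq : ∀ i, q ≤ μ.real (A i)) (a : ℝ) :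
    μ.real {ω | ({i | ω ∈ A i}.ncard : ℝ) ≤ a} ≤ Real.exp (a - Fintype.card ι * (q / 2)) := by
  classical
  set X : ι → Ω → ℝ := fun i => (A i).indicator fun _ => 1 with hX
  have hXm : ∀ i, Measurable (X i) := fun i => measurable_const.indicator (hA i)
  -- Chernoff with parameter `-1`: the factor is `1 - μ(A i)(1 - 1/e)`, and `1 - 1/e ≥ 1/2`.
  have hmgf : ∀ i, mgf (X i) μ (-1) ≤ Real.exp (-(q / 2)) := by
    intro i
    have h1 : (fun ω => Real.exp (-1 * X i ω)) =
        fun ω => 1 - (A i).indicator (fun _ => 1 - Real.exp (-1)) ω := by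
      funext ω
      by_cases h : ω ∈ A i <;> simp [hX, h]
    have h2 : mgf (X i) μ (-1) = 1 - μ.real (A i) * (1 - Real.exp (-1)) := by
      rw [mgf, h1, integral_sub (integrable_const _) ((integrable_const _).indicator (hA i)),
        integral_indicator_const _ (hA i)]
      simp
    have h3 : Real.exp (-1) ≤ 1 / 2 := by
      rw [Real.exp_neg, ← one_div]
      apply one_div_le_one_div_of_le (by norm_num)
      have := Real.add_one_le_exp (1 : ℝ)
      linarith
    have h4 : 0 ≤ μ.real (A i) := measureReal_nonneg
    have h5 := Real.add_one_le_exp (-(q / 2))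
    rw [h2]
    nlinarith [hq i]
  have hsum : ∀ ω, (∑ i, X i) ω = ({i | ω ∈ A i}.ncard : ℝ) := by
    intro ω
    rw [Finset.sum_apply, Set.ncard_eq_toFinset_card']
    simp [hX, Set.indicator_apply]
  have hindf : iIndepFun X μ := hind.iIndepFun_indicator
  have hch := measure_le_le_exp_mul_mgf (μ := μ) (X := ∑ i, X i) (t := -1) a (by norm_num)
    (hindf.integrable_exp_mul_sum hXm (s := Finset.univ) fun i _ => by
      refine Integrable.of_bound (C := 1) ?_ ?_
      · exact (Real.measurable_exp.comp ((hXm i).const_mul _)).aestronglyMeasurable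
      · refine .of_forall fun ω => ?_
        by_cases h : ω ∈ A i <;> simp [hX, h])
  simp only [hsum] at hch
  refine hch.trans ?_
  rw [hindf.mgf_sum hXm Finset.univ, sub_eq_add_neg, Real.exp_add]
  have hprod : ∏ i, mgf (X i) μ (-1) ≤ Real.exp (-(Fintype.card ι * (q / 2))) := by
    calc _ ≤ ∏ _i : ι, Real.exp (-(q / 2)) :=
          Finset.prod_le_prod (fun i _ => mgf_nonneg) fun i _ => hmgf i
      _ = _ := by rw [Finset.prod_const, ← Real.exp_nat_mul, Finset.card_univ]; ring_nf
  simpa using mul_le_mul_of_nonneg_left hprod (Real.exp_pos a).le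

end RandomGraph

/-! ### Upper bound on `tc` for dense random graphs -/

section Dense

open MeasureTheory ProbabilityTheory SimpleGraph

theorem whp_of_compl_le {p : ℕ → unitInterval} {P : ∀ n : ℕ, SimpleGraph (Fin n) → Prop} {ε : ℕ → ℝ}
    (hε : Tendsto ε atTop (𝓝 0))
    (h : ∀ᶠ n : ℕ in atTop, (binomialRandom (Fin n) (p n)).real {G | ¬ P n G} ≤ ε n) :
    Whp p P := by
  have h1 : Tendsto (fun n : ℕ => ENNReal.ofReal (1 - ε n)) atTop (𝓝 1) := by
    have := (ENNReal.continuous_ofReal.tendsto (1 - 0)).comp (hε.const_sub 1)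
    simpa [Function.comp_def] using this
  refine tendsto_of_tendsto_of_tendsto_of_le_of_le' h1 tendsto_const_nhds ?_
    (.of_forall fun n => prob_le_one)
  filter_upwards [h] with n hn
  rw [← ofReal_measureReal]
  apply ENNReal.ofReal_le_ofReal
  have := probReal_compl_eq_one_sub (μ := binomialRandom (Fin n) (p n))
    (measurableSet_simpleGraph {G | P n G})
  rw [show {G | P n G}ᶜ = {G | ¬ P n G} from rfl] at this
  linarith

variable {V : Type*} [Fintype V] {p : unitInterval} {k s M : ℕ}

/-- For distinct `w` outside the tuple, being a common neighbour depends on disjoint sets of edges,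
so the lower tail bound applies to at least `Fintype.card V - k` independent events. -/
theorem measureReal_ncard_commonNeighbors_le (T : Fin k → V) (a : ℝ) :
    (binomialRandom V p).real {G | ({w | ∀ i, G.Adj (T i) w}.ncard : ℝ) ≤ a} ≤
      Real.exp (a - (Fintype.card V - k) * ((p : ℝ) ^ k / 2)) := by
  classical
  let ι := {w : V // w ∉ Finset.univ.image T}
  let B : ι → Finset (Sym2 V) := fun w => Finset.univ.image fun i => s(T i, (w : V))
  let A : ι → Set (SimpleGraph V) := fun w => {G | ∀ e ∈ B w, e ∈ G.edgeSet}
  have hT : ∀ (w : ι) i, T i ≠ w := fun w i h => w.2 (by simp [← h])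
  have hdet : ∀ w, DeterminedBy (B w : Set (Sym2 V)) (A w) := fun w G G' hG hA e he =>
    (hG e he).1 (hA e he)
  have hdisj : Pairwise fun w w' => Disjoint (B w : Set (Sym2 V)) (B w') := by
    intro w w' hww'
    rw [Set.disjoint_left]
    intro e he he'
    simp only [B, Finset.coe_image, Finset.coe_univ, Set.image_univ, Set.mem_range] at he he'
    obtain ⟨i, rfl⟩ := he
    obtain ⟨j, hj⟩ := he'
    rcases Sym2.eq_iff.1 hj with ⟨-, h⟩ | ⟨h, -⟩
    · exact hww' (Subtype.ext h.symm)
    · exact hT w j h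
  -- Only an inequality: a tuple with repeated entries requires fewer than `k` edges.
  have hA : ∀ w, (p : ℝ) ^ k ≤ (binomialRandom V p).real (A w) := fun w => by
    rw [measureReal_forall_mem_edgeSet]
    · refine pow_le_pow_of_le_one p.2.1 p.2.2 ?_
      simpa using Finset.card_image_le (s := (Finset.univ : Finset (Fin k)))
        (f := fun i => s(T i, (w : V)))
    · intro e he
      simp only [B, Finset.mem_image, Finset.mem_univ, true_and] at he
      obtain ⟨i, rfl⟩ := he
      simpa using hT w i
  have hcard : (Fintype.card V : ℝ) - k ≤ Fintype.card ι := by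
    have h1 : Fintype.card ι = Fintype.card V - (Finset.univ.image T).card := by
      rw [Fintype.card_subtype_compl, Fintype.card_coe]
    have h2 : (Finset.univ.image T).card ≤ k := by
      simpa using Finset.card_image_le (s := (Finset.univ : Finset (Fin k))) (f := T)
    have h3 : Fintype.card V ≤ Fintype.card ι + k := by omega
    have : (Fintype.card V : ℝ) ≤ Fintype.card ι + k := by exact_mod_cast h3
    linarith
  refine le_trans ?_ ((measureReal_ncard_lt_le (fun w => measurableSet_simpleGraph (A w))
    (iIndepSet_of_determinedBy hdet hdisj) hA a).trans ?_)
  · refine measureReal_mono fun G hG => ?_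
    simp only [Set.mem_ofPred_eq] at hG ⊢
    refine le_trans ?_ hG
    norm_cast
    refine Set.ncard_le_ncard_of_injOn (fun w : ι => (w : V)) (fun w hw i => ?_)
      Subtype.val_injective.injOn (Set.toFinite _)
    exact hw _ (Finset.mem_image_of_mem _ (Finset.mem_univ i))
  · gcongr
    exact div_nonneg (pow_nonneg p.2.1 _) zero_le_two

theorem measureReal_no_edge_between_le {A B : Finset V} (hA : A.card = s) (hB : B.card = s)
    (hAB : Disjoint A B) :
    (binomialRandom V p).real {G | ∀ a ∈ A, ∀ b ∈ B, ¬ G.Adj a b} ≤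
      Real.exp (-((p : ℝ) * (s : ℝ) ^ 2)) := by
  classical
  let F : Finset (Sym2 V) := (A ×ˢ B).image fun x => s(x.1, x.2)
  have hne : ∀ a ∈ A, ∀ b ∈ B, a ≠ b := fun a ha b hb h =>
    Finset.disjoint_left.1 hAB ha (h ▸ hb)
  have hF : F.card = s ^ 2 := by
    rw [Finset.card_image_of_injOn, Finset.card_product, hA, hB, sq]
    rintro ⟨a, b⟩ hab ⟨a', b'⟩ hab' h
    simp only [Finset.coe_product, Set.mem_prod, Finset.mem_coe] at hab hab'
    rcases Sym2.eq_iff.1 h with ⟨rfl, rfl⟩ | ⟨h1, -⟩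
    · rfl
    · exact absurd h1 (hne _ hab.1 _ hab'.2)
  have hset : {G : SimpleGraph V | ∀ a ∈ A, ∀ b ∈ B, ¬ G.Adj a b} =
      {G | ∀ e ∈ F, e ∉ G.edgeSet} := by
    ext G
    simp only [F, Set.mem_ofPred_eq, Finset.mem_image, Finset.mem_product, Prod.exists]
    constructor
    · rintro h _ ⟨a, b, ⟨ha, hb⟩, rfl⟩
      exact h a ha b hb
    · exact fun h a ha b hb => h _ ⟨a, b, ⟨ha, hb⟩, rfl⟩
  rw [hset, measureReal_forall_notMem_edgeSet, hF]
  · have h1 := Real.add_one_le_exp (-(p : ℝ))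
    calc (1 - (p : ℝ)) ^ s ^ 2 ≤ Real.exp (-p) ^ s ^ 2 :=
          pow_le_pow_left₀ (sub_nonneg.2 p.2.2) (by linarith) _
      _ = _ := by rw [← Real.exp_nat_mul]; push_cast; ring_nf
  · intro e he
    simp only [F, Finset.mem_image, Finset.mem_product, Prod.exists] at he
    obtain ⟨a, b, ⟨ha, hb⟩, rfl⟩ := he
    simpa using hne a ha b hb

/-- The probability that some `k`-tuple has few common neighbours or some two disjoint `s`-sets have
no edge between them. -/
theorem measureReal_not_rich_le (k s M : ℕ) :
    (binomialRandom V p).real {G | ¬ ((∀ T : Fin k → V, s * M ≤ {w | ∀ i, G.Adj (T i) w}.ncard) ∧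
      ∀ A B : Finset V, A.card = s → B.card = s → Disjoint A B → ∃ a ∈ A, ∃ b ∈ B, G.Adj a b)} ≤
      (Fintype.card V : ℝ) ^ k *
        Real.exp (s * M - (Fintype.card V - k) * ((p : ℝ) ^ k / 2)) +
      (Fintype.card V : ℝ) ^ (2 * s) * Real.exp (-((p : ℝ) * (s : ℝ) ^ 2)) := by
  classical
  let X : (Fin k → V) → Set (SimpleGraph V) := fun T =>
    {G | ({w | ∀ i, G.Adj (T i) w}.ncard : ℝ) ≤ ((s * M : ℕ) : ℝ)}
  let ι := Finset.powersetCard s (Finset.univ : Finset V)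
  let Y : ι × ι → Set (SimpleGraph V) := fun x =>
    {G | Disjoint (x.1 : Finset V) x.2 ∧ ∀ a ∈ (x.1 : Finset V), ∀ b ∈ (x.2 : Finset V), ¬ G.Adj a b}
  have hsub : {G : SimpleGraph V | ¬ ((∀ T : Fin k → V, s * M ≤ {w | ∀ i, G.Adj (T i) w}.ncard) ∧
      ∀ A B : Finset V, A.card = s → B.card = s → Disjoint A B → ∃ a ∈ A, ∃ b ∈ B, G.Adj a b)} ⊆
      (⋃ T, X T) ∪ ⋃ x, Y x := by
    intro G hG
    rw [Set.mem_ofPred_eq, not_and_or] at hG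
    rcases hG with hG | hG
    · push Not at hG
      obtain ⟨T, hT⟩ := hG
      refine Or.inl (Set.mem_iUnion.2 ⟨T, ?_⟩)
      simp only [X, Set.mem_ofPred_eq]
      exact_mod_cast hT.le
    · push Not at hG
      obtain ⟨A, B, hA, hB, hAB, h⟩ := hG
      exact Or.inr (Set.mem_iUnion.2 ⟨(⟨A, Finset.mem_powersetCard_univ.2 hA⟩, ⟨B, Finset.mem_powersetCard_univ.2 hB⟩), hAB, h⟩)
  refine (measureReal_mono hsub).trans ((measureReal_union_le _ _).trans (add_le_add ?_ ?_))
  · refine (measureReal_iUnion_le_of_forall_le fun T =>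
      measureReal_ncard_commonNeighbors_le T _).trans_eq ?_
    simp
  · refine (measureReal_iUnion_le_of_forall_le (b := Real.exp (-((p : ℝ) * (s : ℝ) ^ 2)))
      fun x => ?_).trans ?_
    · by_cases hd : Disjoint (x.1 : Finset V) x.2
      · refine le_trans (measureReal_mono fun G hG => hG.2) (measureReal_no_edge_between_le
          (Finset.mem_powersetCard.1 x.1.2).2 (Finset.mem_powersetCard.1 x.2.2).2 hd)
      · have : Y x = ∅ := by
          ext G; simp [Y, hd]
        rw [this, measureReal_empty]
        positivity
    · gcongr
      rw [Fintype.card_prod, two_mul, pow_add]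
      have : Fintype.card ι ≤ Fintype.card V ^ s := by
        simp only [ι, Fintype.card_coe, Finset.card_powersetCard, Finset.card_univ]
        exact Nat.choose_le_pow _ _
      push_cast
      gcongr <;> exact_mod_cast this

/-- The set size is `s ≈ n p ^ k / (8M)`, a small enough share of the expected `n p ^ k` common
neighbours for the tail bound. The union bound over pairs of `s`-sets needs `p s` to exceed a
multiple of `log n`, that is `n p ^ (k + 1) ≥ C log n`: this fixes the exponent `1 / (k + 1)`. -/
theorem rich_asymptotics (k : ℕ) (hM : 0 < M) : ∃ C : ℝ, 0 < C ∧ ∀ᶠ n : ℕ in atTop, ∀ p : ℝ,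
    p ≤ 1 → C * (Real.log n / n) ^ (1 / ((k : ℝ) + 1)) < p → ∃ s : ℕ, 0 < s ∧
      (n : ℝ) ^ k * Real.exp (s * M - (n - k) * (p ^ k / 2)) +
        (n : ℝ) ^ (2 * s) * Real.exp (-(p * (s : ℝ) ^ 2)) ≤ 2 / n := by
  have hM1 : (1 : ℝ) ≤ M := by exact_mod_cast hM
  have hk0 : (0 : ℝ) ≤ k := Nat.cast_nonneg k
  refine ⟨48 * M * (k + 1), by positivity, ?_⟩
  have hlog : ∀ᶠ n : ℕ in atTop, (1 : ℝ) ≤ Real.log n :=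
    (Real.tendsto_log_atTop.comp tendsto_natCast_atTop_atTop).eventually_ge_atTop 1
  filter_upwards [hlog, eventually_ge_atTop (2 * k), eventually_gt_atTop 0] with n hL hnk hn p hp1 hp
  set l := Real.log n with hl
  set C : ℝ := 48 * M * (k + 1) with hC
  have hC1 : 1 ≤ C := by rw [hC]; nlinarith
  have hn0 : (0 : ℝ) < n := by exact_mod_cast hn
  have hnk' : 2 * (k : ℝ) ≤ n := by exact_mod_cast hnk
  have hbase : 0 ≤ l / n := by positivity
  have hp0 : 0 < p := lt_of_le_of_lt (by positivity) hp
  have hpow : C * l ≤ n * p ^ (k + 1) := by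
    have h1 : (C * (l / n) ^ (1 / ((k : ℝ) + 1))) ^ (k + 1) ≤ p ^ (k + 1) :=
      pow_le_pow_left₀ (by positivity) hp.le _
    have h2 : ((l / n) ^ (1 / ((k : ℝ) + 1))) ^ (k + 1) = l / n := by
      rw [← Real.rpow_natCast, ← Real.rpow_mul hbase]
      push_cast
      rw [one_div_mul_cancel (by positivity), Real.rpow_one]
    rw [mul_pow, h2] at h1
    have h3 : C ≤ C ^ (k + 1) := le_self_pow₀ hC1 (by omega)
    have h4 : C * (l / n) ≤ p ^ (k + 1) := (mul_le_mul_of_nonneg_right h3 hbase).trans h1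
    calc C * l = n * (C * (l / n)) := by field_simp
      _ ≤ _ := by gcongr
  set q := p ^ k with hq
  have hq0 : 0 < q := pow_pos hp0 k
  have hpq : p ^ (k + 1) = q * p := pow_succ p k
  rw [hpq] at hpow
  have hnq : C * l ≤ n * q := hpow.trans (by nlinarith [mul_pos hn0 hq0])
  set y := n * q / (8 * M) with hy
  have hyM : y * M = n * q / 8 := by rw [hy]; field_simp
  have hy1 : 1 ≤ y := by
    rw [hy, le_div_iff₀ (by positivity)]
    refine le_trans ?_ hnq
    rw [hC]
    nlinarith [mul_nonneg hk0 (by linarith : (0 : ℝ) ≤ M)]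
  have hs1 : 1 ≤ ⌊y⌋₊ := (Nat.one_le_floor_iff y).2 hy1
  have hsy : (⌊y⌋₊ : ℝ) ≤ y := Nat.floor_le (by linarith)
  have hys : y < ⌊y⌋₊ + 1 := Nat.lt_floor_add_one y
  refine ⟨⌊y⌋₊, hs1, ?_⟩
  set s := ⌊y⌋₊
  have hs1' : (1 : ℝ) ≤ s := by exact_mod_cast hs1
  have hexp : Real.exp l = n := Real.exp_log hn0
  have hone : Real.exp (-l) = 1 / n := by rw [Real.exp_neg, hexp, one_div]
  -- With `n - k ≥ n / 2` the exponent is at most `k l + n q / 8 - n q / 4`, and `n q ≥ 8 (k + 1)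
  -- l`.
  have hA : (n : ℝ) ^ k * Real.exp (s * M - (n - k) * (q / 2)) ≤ 1 / n := by
    rw [← hone, ← hexp, ← Real.exp_nat_mul, ← Real.exp_add, Real.exp_le_exp, hexp]
    have h1 : (s : ℝ) * M ≤ n * q / 8 := hyM ▸ (mul_le_mul_of_nonneg_right hsy (by linarith))
    have h2 : n / 2 * (q / 2) ≤ (n - k) * (q / 2) := by gcongr; linarith
    have h3 : (k + 1) * l * 8 ≤ C * l := by
      rw [hC]
      nlinarith [mul_nonneg (by linarith : (0 : ℝ) ≤ (k : ℝ) + 1) (by linarith : 0 ≤ l)]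
    nlinarith
  have hB : (n : ℝ) ^ (2 * s) * Real.exp (-(p * (s : ℝ) ^ 2)) ≤ 1 / n := by
    rw [← hone, ← hexp, ← Real.exp_nat_mul, ← Real.exp_add, Real.exp_le_exp]
    -- Rounding costs at most a factor `2` since `y ≥ 1`; then `2 s l - p s ^ 2 ≤ -s l ≤ -l`.
    have h1 : 3 * l ≤ p * s := by
      have h2 : p * y ≤ p * (2 * s) := by gcongr; linarith
      have h3 : p * y * (8 * M) = n * (q * p) := by rw [hy]; field_simp
      have h4 : 6 * l * (8 * M) ≤ p * y * (8 * M) := by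
        rw [h3]
        refine le_trans ?_ hpow
        rw [hC]
        nlinarith [mul_nonneg (mul_nonneg hk0 (by linarith : (0 : ℝ) ≤ M)) (by linarith : 0 ≤ l)]
      have h5 := le_of_mul_le_mul_right h4 (by positivity)
      linarith
    push_cast
    nlinarith [mul_le_mul_of_nonneg_left h1 (by linarith : (0 : ℝ) ≤ s),
      mul_le_mul_of_nonneg_right hs1' (by linarith : 0 ≤ l)]
  calc _ ≤ 1 / (n : ℝ) + 1 / n := add_le_add hA hB
    _ = _ := by ring

theorem whp_tc_le {r t k : ℕ} (hr : 0 < r) (hk : ForcesCover r t k) :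
    ∃ C : ℝ, 0 < C ∧ ∀ p : ℕ → unitInterval,
      (∀ᶠ n : ℕ in atTop, C * (Real.log n / n) ^ (1 / ((k : ℝ) + 1)) < (p n : ℝ)) →
        Whp p (fun _ G => tc r G ≤ (t : ℕ∞)) := by
  obtain ⟨I, hfin, hI⟩ := exists_finite_witness.{0, 0} r t
  obtain ⟨C, hC, h⟩ := rich_asymptotics k (M := Nat.card (Fin r → Set I)) Nat.card_pos
  refine ⟨C, hC, fun p hp => whp_of_compl_le (ε := fun n => 2 / (n : ℝ))
    (tendsto_const_div_atTop_nhds_zero_nat 2) ?_⟩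
  filter_upwards [h, hp] with n hn hpn
  obtain ⟨s, hs, hle⟩ := hn (p n) (p n).2.2 hpn
  refine le_trans (measureReal_mono ?_) ((measureReal_not_rich_le k s (Nat.card (Fin r → Set I))).trans ?_)
  · intro G hG hrich
    exact hG (tc_le_of_rich hr hk (fun f hf => hI _ _ f hf) hs hrich.1 hrich.2)
  · simpa using hle

end Dense

/-! ### Lower bound on `tc` for sparse random graphs -/

section Sparse

open MeasureTheory ProbabilityTheory SimpleGraph

variable {V E : Type*} [Fintype V] [Fintype E] {p : unitInterval} {k N : ℕ}

theorem measureReal_le_ncard_adj_le {u : E → V} (hu : Function.Injective u) {w : V}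
    (hw : ∀ a, u a ≠ w) :
    (binomialRandom V p).real {G | k ≤ {a | G.Adj (u a) w}.ncard} ≤
      2 ^ Fintype.card E * (p : ℝ) ^ k := by
  classical
  let ι := Finset.powersetCard k (Finset.univ : Finset E)
  let F : ι → Finset (Sym2 V) := fun D => (D : Finset E).image fun a => s(u a, w)
  have hsub : {G : SimpleGraph V | k ≤ {a | G.Adj (u a) w}.ncard} ⊆
      ⋃ D : ι, {G | ∀ e ∈ F D, e ∈ G.edgeSet} := by
    intro G hG
    simp only [Set.mem_ofPred_eq] at hG
    rw [Set.ncard_eq_toFinset_card'] at hG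
    obtain ⟨D, hD, hDk⟩ := Finset.exists_subset_card_eq hG
    refine Set.mem_iUnion.2 ⟨⟨D, Finset.mem_powersetCard_univ.2 hDk⟩, fun e he => ?_⟩
    obtain ⟨a, ha, rfl⟩ := Finset.mem_image.1 he
    simpa using hD ha
  refine (measureReal_mono hsub).trans ((measureReal_iUnion_le_of_forall_le
    (b := (p : ℝ) ^ k) fun D => ?_).trans ?_)
  · rw [measureReal_forall_mem_edgeSet, Finset.card_image_of_injective,
      (Finset.mem_powersetCard.1 D.2).2]
    · intro a b hab
      rcases Sym2.eq_iff.1 hab with ⟨h, -⟩ | ⟨h, -⟩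
      · exact hu h
      · exact absurd h (hw a)
    · intro e he
      obtain ⟨a, ha, rfl⟩ := Finset.mem_image.1 he
      simpa using hw a
  · have : Fintype.card ι ≤ 2 ^ Fintype.card E := by
      simp only [ι, Fintype.card_coe, Finset.card_powersetCard, Finset.card_univ]
      exact Nat.choose_le_two_pow _ _
    have hp : (0 : ℝ) ≤ (p : ℝ) ^ k := pow_nonneg p.2.1 k
    gcongr
    exact_mod_cast this

/-- Among `N` disjoint copies of `E`, the probability that none of them is an independent set without
`k` vertices having a common neighbour. -/
theorem measureReal_no_sparse_copy_le {u : Fin N × E → V} (hu : Function.Injective u) (hk : 0 < k)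
    {x : ℝ} (hx : 2 ^ Fintype.card E * (p : ℝ) ^ k ≤ x) (hx1 : x ≤ 1) :
    (binomialRandom V p).real {G | ¬ ∃ i, (∀ a b, ¬ G.Adj (u (i, a)) (u (i, b))) ∧
      ∀ w, {a | G.Adj (u (i, a)) w}.ncard < k} ≤
      ((N * Fintype.card E : ℕ) : ℝ) ^ 2 * p + (1 - (1 - x) ^ Fintype.card V) ^ N := by
  classical
  -- Only vertices outside all copies are tested. The events for distinct pairs (copy, vertex) then
  -- use disjoint edges, and vertices inside copies are handled by the event `X` that some edge
  -- joins two copy vertices.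
  let W := {w : V // ∀ y, u y ≠ w}
  let X : (Fin N × E) × (Fin N × E) → Set (SimpleGraph V) := fun y => {G | G.Adj (u y.1) (u y.2)}
  let Z : Fin N × W → Set (SimpleGraph V) := fun y =>
    {G | k ≤ {a | G.Adj (u (y.1, a)) y.2}.ncard}
  let B : Fin N × W → Set (Sym2 V) := fun y => {e | ∃ a, e = s(u (y.1, a), (y.2 : V))}
  have hdet : ∀ y, DeterminedBy (B y) (Z y) := by
    intro y G G' hG hA
    have : {a | G.Adj (u (y.1, a)) y.2} = {a | G'.Adj (u (y.1, a)) y.2} := by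
      ext a; exact hG _ ⟨a, rfl⟩
    simp only [Z, Set.mem_ofPred_eq] at hA ⊢
    rwa [← this]
  have hB : Pairwise fun y y' => Disjoint (B y) (B y') := by
    intro y y' hyy'
    rw [Set.disjoint_left]
    rintro _ ⟨a, rfl⟩ ⟨b, hb⟩
    rcases Sym2.eq_iff.1 hb with ⟨h1, h2⟩ | ⟨h1, -⟩
    · exact hyy' (Prod.ext (Prod.ext_iff.1 (hu h1)).1 (Subtype.ext h2))
    · exact y'.2.2 _ h1
  let Y : Fin N → Set (SimpleGraph V) := fun i => (⋂ w ∈ (Finset.univ : Finset W), (Z (i, w))ᶜ)ᶜ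
  have hYdet : ∀ i, DeterminedBy (⋃ w ∈ (Finset.univ : Finset W), B (i, w)) (Y i) := fun i =>
    (DeterminedBy.biInter fun w _ => (hdet (i, w)).compl).compl
  have hYB : Pairwise fun i j : Fin N => Disjoint (⋃ w ∈ (Finset.univ : Finset W), B (i, w))
      (⋃ w ∈ (Finset.univ : Finset W), B (j, w)) := by
    intro i j hij
    simp only [Set.disjoint_iUnion_right, Set.disjoint_iUnion_left]
    exact fun w _ w' _ => hB fun h => hij (Prod.ext_iff.1 h).1
  have hsub : {G : SimpleGraph V | ¬ ∃ i, (∀ a b, ¬ G.Adj (u (i, a)) (u (i, b))) ∧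
      ∀ w, {a | G.Adj (u (i, a)) w}.ncard < k} ⊆
      (⋃ y, X y) ∪ ⋂ i ∈ (Finset.univ : Finset (Fin N)), Y i := by
    intro G hG
    by_contra hcon
    simp only [Set.mem_union, Set.mem_iUnion, X, Set.mem_ofPred_eq, not_or, not_exists,
      Set.mem_iInter, Finset.mem_univ, true_imp_iff, not_forall, Y, Set.mem_compl_iff, not_not,
      Z, not_le] at hcon
    obtain ⟨h1, i, hi⟩ := hcon
    refine hG ⟨i, fun a b => h1 ((i, a), (i, b)), fun w => ?_⟩
    by_cases hw : ∀ y, u y ≠ w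
    · exact hi ⟨w, hw⟩
    · push Not at hw
      obtain ⟨y, rfl⟩ := hw
      -- Without edges among copy vertices, such a vertex has no neighbour in the copy; `0 < k`
      -- finishes.
      have : {a | G.Adj (u (i, a)) (u y)} = ∅ := by
        ext a; simpa using h1 ((i, a), y)
      rwa [this, Set.ncard_empty]
  have hx0 : 0 ≤ x := le_trans (by have := pow_nonneg p.2.1 k; positivity) hx
  refine (measureReal_mono hsub).trans ((measureReal_union_le _ _).trans (add_le_add ?_ ?_))
  · refine (measureReal_iUnion_le_of_forall_le (b := (p : ℝ)) fun y => ?_).trans_eq ?_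
    · by_cases hy : u y.1 = u y.2
      · have : X y = ∅ := by ext G; simp [X, hy]
        rw [this, measureReal_empty]
        exact p.2.1
      · exact (measureReal_mem_edgeSet (e := s(u y.1, u y.2)) (by simpa using hy)).le
    · simp [sq]
  · rw [measureReal_biInter_of_determinedBy hYdet hYB]
    have hY : ∀ i, (binomialRandom V p).real (Y i) ≤ 1 - (1 - x) ^ Fintype.card V := by
      intro i
      rw [probReal_compl_eq_one_sub (measurableSet_simpleGraph _),
        measureReal_biInter_of_determinedBy (fun w : W => (hdet (i, w)).compl)
          (fun w w' h => hB fun h' => h (Prod.ext_iff.1 h').2)]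
      have h1 : ∀ w : W, 1 - x ≤ (binomialRandom V p).real (Z (i, w))ᶜ := by
        intro w
        rw [probReal_compl_eq_one_sub (measurableSet_simpleGraph _)]
        have := (measureReal_le_ncard_adj_le (p := p) (k := k) (u := fun a => u (i, a))
          (fun a b h => (Prod.ext_iff.1 (hu h)).2) (w := (w : V)) fun a => w.2 (i, a)).trans hx
        exact sub_le_sub_left this 1
      have h2 : (1 - x) ^ Fintype.card V ≤ ∏ w : W, (binomialRandom V p).real (Z (i, w))ᶜ := by
        calc (1 - x) ^ Fintype.card V ≤ (1 - x) ^ Fintype.card W :=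
              pow_le_pow_of_le_one (by linarith) (by linarith) (Fintype.card_subtype_le _)
          _ = ∏ _w : W, (1 - x) := by simp
          _ ≤ _ := Finset.prod_le_prod (fun _ _ => by linarith) fun w _ => h1 w
      linarith
    calc _ ≤ ∏ _i : Fin N, (1 - (1 - x) ^ Fintype.card V) :=
          Finset.prod_le_prod (fun _ _ => measureReal_nonneg) fun i _ => hY i
      _ = _ := by simp

theorem exp_neg_two_mul_le {x : ℝ} (hx0 : 0 ≤ x) (hx : x ≤ 1 / 2) : Real.exp (-(2 * x)) ≤ 1 - x := by
  have h1 := Real.add_one_le_exp (2 * x)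
  rw [Real.exp_neg, inv_le_comm₀ (Real.exp_pos _) (by linarith)]
  refine le_trans ?_ h1
  rw [inv_le_iff_one_le_mul₀ (by linarith)]
  nlinarith

/-- With `δ = 1 / (8k)` and `x = (δ / 2) log n / n`, one copy succeeds with probability at least `(1
- x) ^ n ≥ n ^ (-δ)`. Taking `N ≈ n ^ (2δ)` copies makes the expected number of successes at least
about `n ^ δ`, while `N ^ 2 ≤ n ^ (1 / (2k))` is small enough that `N ^ 2 p → 0`, so the copies
typically span no edges. -/
theorem sparse_asymptotics (m : ℕ) (hk : 0 < k) : ∃ c : ℝ, 0 < c ∧ ∃ (N : ℕ → ℕ) (ε : ℕ → ℝ),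
    Tendsto ε atTop (𝓝 0) ∧ ∀ᶠ n : ℕ in atTop, N n * m ≤ n ∧ ∀ p : ℝ, 0 ≤ p →
      p < c * (Real.log n / n) ^ (1 / (k : ℝ)) → ∃ x : ℝ, 2 ^ m * p ^ k ≤ x ∧ x ≤ 1 ∧
        ((N n * m : ℕ) : ℝ) ^ 2 * p + (1 - (1 - x) ^ n) ^ N n ≤ ε n := by
  have hk1 : (1 : ℝ) ≤ k := by exact_mod_cast hk
  set δ : ℝ := 1 / (8 * k) with hδ
  have hδ0 : 0 < δ := by positivity
  set c : ℝ := 1 / (2 ^ (m + 4) * k) with hc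
  have hc0 : 0 < c := by positivity
  have hc1 : c ≤ 1 := by
    rw [hc, div_le_one (by positivity)]
    nlinarith [one_le_pow₀ (n := m + 4) (by norm_num : (1 : ℝ) ≤ 2)]
  -- The factor `2 ^ m` pays for the choice of `k` vertices in a copy; `c` is chosen to absorb it.
  have hcm : 2 ^ m * c = δ / 2 := by
    rw [hc, hδ, pow_add]; field_simp; norm_num
  have hlogdiv : Tendsto (fun n : ℕ => Real.log n / (n : ℝ) ^ (1 / 2 : ℝ)) atTop (𝓝 0) :=
    (isLittleO_log_rpow_atTop (by norm_num : (0 : ℝ) < 1 / 2)).tendsto_div_nhds_zero.comp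
      tendsto_natCast_atTop_atTop
  have hpowδ : Tendsto (fun n : ℕ => (n : ℝ) ^ δ) atTop atTop :=
    (tendsto_rpow_atTop hδ0).comp tendsto_natCast_atTop_atTop
  refine ⟨c, hc0, fun n => ⌊(n : ℝ) ^ (2 * δ)⌋₊, fun n =>
    (m : ℝ) ^ 2 * (c * (Real.log n / (n : ℝ) ^ (1 / 2 : ℝ)) ^ (1 / (k : ℝ))) +
      Real.exp (-((n : ℝ) ^ δ / 2)), ?_, ?_⟩
  · have h1 : Tendsto (fun n : ℕ => (Real.log n / (n : ℝ) ^ (1 / 2 : ℝ)) ^ (1 / (k : ℝ)))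
        atTop (𝓝 0) := by
      have := hlogdiv.rpow_const (p := 1 / (k : ℝ)) (Or.inr (by positivity))
      rwa [Real.zero_rpow (by positivity)] at this
    have h2 : Tendsto (fun n : ℕ => Real.exp (-((n : ℝ) ^ δ / 2))) atTop (𝓝 0) :=
      Real.tendsto_exp_neg_atTop_nhds_zero.comp (hpowδ.atTop_div_const (by norm_num))
    simpa using ((h1.const_mul c).const_mul ((m : ℝ) ^ 2)).add h2
  · have hsqrt : ∀ᶠ n : ℕ in atTop, (m : ℝ) ≤ (n : ℝ) ^ (1 / 2 : ℝ) :=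
      ((tendsto_rpow_atTop (by norm_num : (0 : ℝ) < 1 / 2)).comp
        tendsto_natCast_atTop_atTop).eventually_ge_atTop _
    filter_upwards [hsqrt, eventually_ge_atTop 1] with n hm hn
    have hn1 : (1 : ℝ) ≤ n := by exact_mod_cast hn
    have hn0 : (0 : ℝ) < n := by linarith
    have hl0 : 0 ≤ Real.log n := Real.log_nonneg hn1
    set N := ⌊(n : ℝ) ^ (2 * δ)⌋₊ with hN
    have hδhalf : 2 * δ ≤ 1 / 2 := by
      rw [hδ, mul_one_div, div_le_iff₀ (by positivity)]; linarith
    have hNle : (N : ℝ) ≤ (n : ℝ) ^ (2 * δ) := Nat.floor_le (by positivity)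
    refine ⟨?_, fun p hp0 hp => ?_⟩
    · have : (N : ℝ) * m ≤ n := by
        calc (N : ℝ) * m ≤ (n : ℝ) ^ (1 / 2 : ℝ) * (n : ℝ) ^ (1 / 2 : ℝ) := by
              gcongr
              exact hNle.trans (Real.rpow_le_rpow_of_exponent_le hn1 hδhalf)
          _ = n := by rw [← Real.rpow_add hn0]; norm_num
      exact_mod_cast this
    · have hbase : 0 ≤ Real.log n / n := by positivity
      have hpk : p ^ k ≤ c * (Real.log n / n) := by
        calc p ^ k ≤ (c * (Real.log n / n) ^ (1 / (k : ℝ))) ^ k := pow_le_pow_left₀ hp0 hp.le _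
          _ = c ^ k * (Real.log n / n) := by
            rw [mul_pow, ← Real.rpow_natCast (_ ^ _) k, ← Real.rpow_mul hbase,
              one_div_mul_cancel (by positivity), Real.rpow_one]
          _ ≤ c * (Real.log n / n) := by
            gcongr
            exact pow_le_of_le_one hc0.le hc1 hk.ne'
      set x := δ / 2 * (Real.log n / n) with hx
      have hx0 : 0 ≤ x := by positivity
      have hxhalf : x ≤ 1 / 2 := by
        have h1 : Real.log n / n ≤ 1 := by
          rw [div_le_one hn0]; linarith [Real.log_le_sub_one_of_pos hn0]
        have h2 : δ ≤ 1 := by linarith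
        rw [hx]
        nlinarith
      refine ⟨x, ?_, by linarith, add_le_add ?_ ?_⟩
      · rw [hx, ← hcm, mul_assoc]
        gcongr
      · have h1 : (N : ℝ) ^ 2 * (Real.log n / n) ^ (1 / (k : ℝ)) ≤
            (Real.log n / (n : ℝ) ^ (1 / 2 : ℝ)) ^ (1 / (k : ℝ)) := by
          have h2 : (N : ℝ) ^ 2 ≤ ((n : ℝ) ^ (1 / 2 : ℝ)) ^ (1 / (k : ℝ)) := by
            calc (N : ℝ) ^ 2 ≤ ((n : ℝ) ^ (2 * δ)) ^ 2 := by gcongr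
              _ = _ := by
                rw [← Real.rpow_natCast, ← Real.rpow_mul hn0.le, ← Real.rpow_mul hn0.le, hδ]
                congr 1
                push_cast; field_simp; norm_num
          calc _ ≤ ((n : ℝ) ^ (1 / 2 : ℝ)) ^ (1 / (k : ℝ)) * (Real.log n / n) ^ (1 / (k : ℝ)) := by
                gcongr
            _ = ((n : ℝ) ^ (1 / 2 : ℝ) * (Real.log n / n)) ^ (1 / (k : ℝ)) := by
                rw [Real.mul_rpow (by positivity) hbase]
            _ = _ := by
                congr 1
                have h3 : (n : ℝ) ^ (1 / 2 : ℝ) * (n : ℝ) ^ (1 / 2 : ℝ) = n := by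
                  rw [← Real.rpow_add hn0]; norm_num
                rw [mul_div_assoc', div_eq_div_iff hn0.ne' (by positivity)]
                linear_combination Real.log n * h3
        calc ((N * m : ℕ) : ℝ) ^ 2 * p ≤
              ((N * m : ℕ) : ℝ) ^ 2 * (c * (Real.log n / n) ^ (1 / (k : ℝ))) := by gcongr
          _ = (m : ℝ) ^ 2 * (c * ((N : ℝ) ^ 2 * (Real.log n / n) ^ (1 / (k : ℝ)))) := by
              push_cast; ring
          _ ≤ _ := by gcongr
      · have hpow : (n : ℝ) ^ (-δ) ≤ (1 - x) ^ n := by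
          calc (n : ℝ) ^ (-δ) = Real.exp (-(2 * x)) ^ n := by
                rw [Real.rpow_def_of_pos hn0, ← Real.exp_nat_mul, hx]
                congr 1
                field_simp
            _ ≤ _ := pow_le_pow_left₀ (Real.exp_pos _).le (exp_neg_two_mul_le hx0 hxhalf) _
        have hle1 : (1 - x) ^ n ≤ 1 := pow_le_one₀ (by linarith) (by linarith)
        set z := (1 - x) ^ n with hz
        have hNge : (n : ℝ) ^ (2 * δ) / 2 ≤ N := by
          have h1 : (1 : ℝ) ≤ (n : ℝ) ^ (2 * δ) := Real.one_le_rpow hn1 (by positivity)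
          have h2 : (1 : ℝ) ≤ N := by exact_mod_cast (Nat.one_le_floor_iff _).2 h1
          have h3 := Nat.lt_floor_add_one ((n : ℝ) ^ (2 * δ))
          linarith
        calc (1 - z) ^ N ≤ Real.exp (-z) ^ N :=
              pow_le_pow_left₀ (by linarith) (by linarith [Real.add_one_le_exp (-z)]) _
          _ = Real.exp (-(N * z)) := by rw [← Real.exp_nat_mul]; ring_nf
          _ ≤ _ := by
              rw [Real.exp_le_exp, neg_le_neg_iff]
              calc (n : ℝ) ^ δ / 2 = (n : ℝ) ^ (2 * δ) / 2 * (n : ℝ) ^ (-δ) := by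
                    rw [div_mul_eq_mul_div, ← Real.rpow_add hn0]; ring_nf
                _ ≤ N * z := by gcongr

theorem whp_lt_tc {r t : ℕ} {E L : Type} [Finite E] (hk : 0 < k) {f : E → Fin r → L}
    (hf : HasSelector (k - 1) f) (hft : ¬ Coverable f t) :
    ∃ c : ℝ, 0 < c ∧ ∀ p : ℕ → unitInterval,
      (∀ᶠ n : ℕ in atTop, (p n : ℝ) < c * (Real.log n / n) ^ (1 / (k : ℝ))) →
        Whp p (fun _ G => (t : ℕ∞) < tc r G) := by
  have := Fintype.ofFinite E
  obtain ⟨c, hc, N, ε, hε, h⟩ := sparse_asymptotics (Fintype.card E) hk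
  refine ⟨c, hc, fun p hp => whp_of_compl_le hε ?_⟩
  filter_upwards [h, hp] with n hn hpn
  obtain ⟨x, hx, hx1, hle⟩ := hn.2 (p n) (p n).2.1 hpn
  have hcard : Fintype.card (Fin (N n) × E) ≤ Fintype.card (Fin n) := by simpa using hn.1
  obtain ⟨u⟩ := Function.Embedding.nonempty_of_card_le hcard
  refine le_trans (measureReal_mono ?_)
    ((measureReal_no_sparse_copy_le u.injective hk hx hx1).trans ?_)
  -- Fewer than `k` neighbours means at most `k - 1`, the tuple length that `f` has a selector for.
  · rintro G hG ⟨i, hind, hnb⟩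
    exact hG (lt_tc_of_sparse_copy hf hft (u := fun a => u (i, a))
      (fun a b hab => (Prod.ext_iff.1 (u.injective hab)).2) hind
      fun w => Nat.le_sub_one_of_lt (hnb w))
  · simpa using hle

end Sparse

end TreeCover

theorem theorem1p3 (r t k : ℕ) (hr : 0 < r) (ht : 0 < t) (hk : TreeCover.kc r t = (k : ℕ∞)) :
    ∃ C c : ℝ, 0 < C ∧ 0 < c ∧
      (∀ p : ℕ → unitInterval,
        (∀ᶠ n : ℕ in atTop, (p n : ℝ) < c * (Real.log n / n) ^ (1 / (k : ℝ))) →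
          TreeCover.Whp p (fun _ G => (t : ℕ∞) < TreeCover.tc r G)) ∧
      (∀ p : ℕ → unitInterval,
        (∀ᶠ n : ℕ in atTop, C * (Real.log n / n) ^ (1 / ((k : ℝ) + 1)) < (p n : ℝ)) →
          TreeCover.Whp p (fun _ G => TreeCover.tc r G ≤ (t : ℕ∞))) := by
  have hforce := TreeCover.forcesCover_of_kc_eq hk
  obtain ⟨E, L, _, f, hf, hft⟩ := TreeCover.exists_not_coverable hr hk
  obtain ⟨C, hC, hupper⟩ := TreeCover.whp_tc_le hr hforce
  obtain ⟨c, hc, hlower⟩ := TreeCover.whp_lt_tc hforce.1 hf hft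
  exact ⟨C, c, hC, hc, hlower, hupper⟩
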